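/- Let $\mathcal L$ be a countable relational language and let $M$ be a countably infinite $\mathcal L$-structure that is ultrahomogeneous (every isomorphism between finite substructures of $M$ extends to an automorphism of $M$) and has no algebraicity (for every finite tuple $X$ of elements of $M$ and every $a\in M$ not in $X$, the orbit of $a$ under the pointwise stabilizer of $X$ in $\mathrm{Aut}(M)$ is infinite). Let $\mathcal K=\mathrm{Age}(M)$ be the class of all finite $\mathcal L$-structures that embed in $M$. For $C\in\mathcal K$, say that $C$ splits $\mathcal K$ if for every $D\in\mathcal K$ and every embedding $i:C\to D$ there are $D_1,D_2\in\mathcal K$, embeddings $j_1:D\to D_1$, $j_2:D\to D_2$ and a bijection $f$ from the domain of $D_1$ onto that of $D_2$ such that (a) $f\circ j_1=j_2$; (b) $f$ restricts to an isomorphism from the substructure of $D_1$ on $D_1\setminus j_1(i(C))$ onto the substructure of $D_2$ on $D_2\setminus j_2(i(C))$; (c) $f$ is not an isomorphism from $D_1$ to $D_2$. Say that $\mathcal K$ splits if some $C\in\mathcal K$ splits $\mathcal K$. Subsets of $M$ are identified with the substructures of $M$ that they induce and, through characteristic functions, with points of the Cantor space $2^M$. For substructures $A,B$ of $M$ let $\mathrm{Iso}(A,B)$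 be the space of isomorphisms from $A$ onto $B$ with the topology of pointwise convergence ($B$ being discrete), let $\mathcal E(A,B)\subseteq\mathrm{Iso}(A,B)$ be the set of those isomorphisms that extend to an automorphism of $M$, and put $\mathrm{Iso}(A)=\mathrm{Iso}(A,A)$, $\mathcal E(A)=\mathcal E(A,A)$. Call $A$ global if $\mathcal E(A)=\mathrm{Iso}(A)$, and strongly non-global if $\mathcal E(A)$ is a meager subset of $\mathrm{Iso}(A)$. Call a pair $A,B$ of isomorphic substructures a global pair if $\mathcal E(A,B)=\mathrm{Iso}(A,B)$, and a strongly non-global pair if $\mathcal E(A,B)$ is a meager subset of $\mathrm{Iso}(A,B)$. A property holds for the generic substructure (the generic pair) if the set of all $A\in 2^M$ (all $(A,B)\in 2^M\times 2^M$) that have it is comeager. Then: 1. If $\mathcal K$ splits, then the generic substructure of $M$ is strongly non-global, and the generic pair of substructures of $M$ consists of isomorphic substructures and is a strongly non-global pair. 2. If $\mathcal K$ does not split, then the generic substructure of $M$ is global, and the generic pair of substructures of $M$ consists of isomorphic substructures and is a global pair. -/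

import Mathlib

open FirstOrder

universe u v w w'

namespace GenericSubstructure

section Structures

variable {L : FirstOrder.Language.{u, v}}

/-- In a relational language every subset `S` of a structure carries a substructure with
domain `S`. -/
def induced (L : FirstOrder.Language.{u, v}) [L.IsRelational] {N : Type w} [L.Structure N] (S : Set N) :
    L.Substructure N where
  carrier := S
  fun_mem := fun f => isEmptyElim f

/-- The substructure of `M` with characteristic function `χ`, a point of the Cantor space
`2 ^ M = (M → Bool)`. -/
def ofChar (L : FirstOrder.Language.{u, v}) [L.IsRelational] {M : Type w} [L.Structure M] (χ : M → Bool) :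
    L.Substructure M :=
  induced L {x | χ x = true}

/-- `M` has no algebraicity: for every finite tuple `X` of `M`, the pointwise stabilizer of `X` in
`Aut(M)` has no finite orbit on `M` outside of `X` (the points of `X` themselves are fixed). -/
def NoAlgebraicity (L : FirstOrder.Language.{u, v}) (M : Type w) [L.Structure M] : Prop :=
  ∀ (X : Finset M) (a : M), a ∉ X →
    {b : M | ∃ g : M ≃[L] M, (∀ x ∈ X, g x = x) ∧ g a = b}.Infinite

/-- The structure `C` splits the class `K`. -/
def StructureSplits [L.IsRelational] (K : Set (CategoryTheory.Bundled.{w} L.Structure))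
    (C : CategoryTheory.Bundled.{w} L.Structure) : Prop :=
  ∀ D ∈ K, ∀ i : C ↪[L] D,
    ∃ D₁ ∈ K, ∃ D₂ ∈ K, ∃ (j₁ : D ↪[L] D₁) (j₂ : D ↪[L] D₂) (f : D₁ ≃ D₂),
      (∀ x : D, f (j₁ x) = j₂ x) ∧
      (∃ e : induced L (Set.range fun c : C => j₁ (i c))ᶜ ≃[L]
          induced L (Set.range fun c : C => j₂ (i c))ᶜ, ∀ x, (e x : D₂) = f x) ∧
      ¬ ∃ e : D₁ ≃[L] D₂, ∀ x, e x = f x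

/-- The class `K` splits if some member of `K` splits it. -/
def Splits [L.IsRelational] (K : Set (CategoryTheory.Bundled.{w} L.Structure)) : Prop :=
  ∃ C ∈ K, StructureSplits K C

/-- The topology of pointwise convergence on the space `Iso(N, P)` of isomorphisms, where `P` is
discrete. -/
instance isoTopology (N : Type w) (P : Type w') [L.Structure N] [L.Structure P] :
    TopologicalSpace (N ≃[L] P) :=
  TopologicalSpace.induced (fun (h : N ≃[L] P) (x : N) => h x)
    (@Pi.topologicalSpace N (fun _ => P) (fun _ => ⊥))

variable {M : Type w} [L.Structure M]

/-- `E(A, B)`: the isomorphisms from `A` to `B` that extend to an automorphism of `M`. -/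
def extendable (A B : L.Substructure M) : Set (A ≃[L] B) :=
  {h | ∃ g : M ≃[L] M, ∀ x : A, g (x : M) = (h x : M)}

/-- A pair of isomorphic substructures `A`, `B` of `M` is global if `E(A, B) = Iso(A, B)`. -/
def IsGlobalPair (A B : L.Substructure M) : Prop :=
  Nonempty (A ≃[L] B) ∧ extendable A B = Set.univ

/-- A pair of isomorphic substructures `A`, `B` of `M` is strongly non-global if `E(A, B)` is a
meager subset of `Iso(A, B)`. -/
def IsStronglyNonGlobalPair (A B : L.Substructure M) : Prop :=
  Nonempty (A ≃[L] B) ∧ IsMeagre (extendable A B)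

/-- A substructure `A` of `M` is global if `E(A) = Iso(A)`. -/
def IsGlobal (A : L.Substructure M) : Prop :=
  extendable A A = Set.univ

/-- A substructure `A` of `M` is strongly non-global if `E(A)` is a meager subset of `Iso(A)`. -/
def IsStronglyNonGlobal (A : L.Substructure M) : Prop :=
  IsMeagre (extendable A A)

end Structures

end GenericSubstructure

namespace GenericSubstructure

open FirstOrder.Language Set

variable {L : FirstOrder.Language.{u, v}} {M : Type w} [L.Structure M]

/-! Genericity enters only through `RealizesTypes`: without algebraicity, a comeager set of
colorings realizes every one-point type over a finite set in both colors. Back-and-forth then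
extends every finite color-preserving restriction of an automorphism to a color-preserving
automorphism.

By ultrahomogeneity, splitting can be read inside `M`: non-splitting gives each finite `C` a finite
`D ⊇ C` with `Determines L C D`, while splitting gives a finite `C` for which no finite `D ⊇ C`
works.

Without splitting, an isomorphism `h : A → B` is extended one point at a time, keeping `h` together
with finitely many new values locally extendable (`Compatible`). If `C` is the part of the finite
domain outside `A`, a suitable `D` is placed with `D \ C ⊆ A`. Values correct on `D` are then
correct over all of `A`, since off `C` only `h` is involved (`Compatible.exists_insert`).

With splitting, move `C` outside `A`. Extendable isomorphisms lie in the countable union, over maps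
`γ : C → M`, of the closed sets of isomorphisms compatible with `γ`. Each has empty interior: a
finite part of `h` never determines the structure over `C`, so `h` can be altered elsewhere to
contradict `γ` (`Compatible.exists_agree_not_compatible`). -/

lemma relMap_coe {N : Type*} [L.Structure N] (S : L.Substructure N) {n : ℕ} (R : L.Relations n)
    (x : Fin n → S) : Structure.RelMap R (fun i => (x i : N)) ↔ Structure.RelMap R x :=
  S.subtype.map_rel R x

/-- A bijection restricts to an isomorphism between induced substructures if and only if it
matches the domains and preserves the relations there. -/
lemma exists_equiv_induced_iff [L.IsRelational] {N P : Type*} [L.Structure N] [L.Structure P]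
    (f : N ≃ P) (S : Set N) (T : Set P) :
    (∃ e : induced L S ≃[L] induced L T, ∀ x, (e x : P) = f x) ↔
      (∀ a, a ∈ S ↔ f a ∈ T) ∧ ∀ (n : ℕ) (R : L.Relations n) (x : Fin n → N), (∀ i, x i ∈ S) →
        (Structure.RelMap R (fun i => f (x i)) ↔ Structure.RelMap R x) := by
  constructor
  · rintro ⟨e, he⟩
    refine ⟨fun a => ⟨fun ha => ?_, fun ha => ?_⟩, fun n R x hx => ?_⟩
    · rw [← he ⟨a, ha⟩]
      exact (e ⟨a, ha⟩).2
    · have h := he (e.symm ⟨f a, ha⟩)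
      rw [e.apply_symm_apply] at h
      have h' : a = _ := f.injective h
      rw [h']
      exact (e.symm ⟨f a, ha⟩).2
    · have h := e.map_rel R (fun i => (⟨x i, hx i⟩ : induced L S))
      rw [← relMap_coe, ← relMap_coe (induced L S)] at h
      simpa only [Function.comp_apply, he] using h
  · rintro ⟨h₁, h₂⟩
    refine ⟨⟨f.subtypeEquiv h₁, fun g => isEmptyElim g, fun {n} R x => ?_⟩, fun x => rfl⟩
    rw [← relMap_coe, ← relMap_coe (induced L S)]
    exact h₂ n R (fun i => (x i : N)) fun i => (x i).2

/-- Any two embeddings of a finite structure into an ultrahomogeneous one differ by an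
automorphism. -/
lemma exists_aut_comp_eq (hM : L.IsUltrahomogeneous M) {N : Type*} [L.Structure N] [Finite N]
    (u v : N ↪[L] M) : ∃ g : M ≃[L] M, ∀ x, g (u x) = v x := by
  obtain ⟨g, hg⟩ := hM u.toHom.range (Structure.FG.range Structure.FG.of_finite u.toHom)
    (v.comp u.equivRange.symm.toEmbedding)
  refine ⟨g, fun x => ?_⟩
  have h := DFunLike.congr_fun hg (u.equivRange x)
  simpa using h.symm

/-! ### Splitting expressed inside `M` -/

/-- The restriction of `φ` to `S` extends to an automorphism. -/
def ExtendsOn (L : FirstOrder.Language.{u, v}) [L.Structure M] (S : Set M) (φ : M → M) : Prop :=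
  ∃ g : M ≃[L] M, ∀ x ∈ S, g x = φ x

/-- Over the finite set `D`, the structure of every finite extension of `D` is determined by its
restriction to the complement of `C`. -/
def Determines (L : FirstOrder.Language.{u, v}) [L.Structure M] (C D : Set M) : Prop :=
  ∀ D₁ : Set M, D₁.Finite → D ⊆ D₁ → ∀ φ : M → M, InjOn φ D₁ → ExtendsOn L D φ →
    ExtendsOn L (D₁ \ C) φ → ExtendsOn L D₁ φ

lemma Determines.image {C D : Set M} (h : Determines L C D) (g : M ≃[L] M) :
    Determines L (g '' C) (g '' D) := by
  rintro D₁ hfin hD φ hφ ⟨g₁, h₁⟩ ⟨g₂, h₂⟩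
  obtain ⟨k, hk⟩ := h (g ⁻¹' D₁) (hfin.preimage g.injective.injOn) (fun x hx => hD ⟨x, hx, rfl⟩)
    (φ ∘ g) (hφ.comp g.injective.injOn fun x hx => hx)
    ⟨g₁.comp g, fun x hx => h₁ _ ⟨x, hx, rfl⟩⟩
    ⟨g₂.comp g, fun x hx => h₂ _ ⟨hx.1, by
      rintro ⟨y, hy, hyx⟩
      exact hx.2 (g.injective hyx ▸ hy)⟩⟩
  refine ⟨k.comp g.symm, fun x hx => ?_⟩
  have := hk (g.symm x) (by simpa using hx)
  simpa using this

lemma mem_age_induced [L.IsRelational] {S : Set M} (hS : S.Finite) :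
    CategoryTheory.Bundled.of (c := L.Structure) (induced L S) ∈ L.age M :=
  have : Finite (induced L S) := hS.to_subtype
  ⟨Structure.FG.of_finite (M := induced L S), ⟨(induced L S).subtype⟩⟩

lemma exists_determines [L.IsRelational] (hM : L.IsUltrahomogeneous M)
    (hns : ¬ Splits (L.age M)) {C : Set M} (hC : C.Finite) :
    ∃ D, D.Finite ∧ C ⊆ D ∧ Determines L C D := by
  have h₀ : ¬ StructureSplits (L.age M) (CategoryTheory.Bundled.of (induced L C)) :=
    fun h => hns ⟨_, mem_age_induced hC, h⟩
  unfold StructureSplits at h₀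
  push Not at h₀
  obtain ⟨D, ⟨hDfg, ⟨k⟩⟩, i, hi⟩ := h₀
  have : Finite (induced L C) := hC.to_subtype
  have : Finite D := hDfg.finite
  -- Place the extension witnessing non-splitting in `M` so that its copy of `C` is `C` itself; its
  -- image is the required set.
  obtain ⟨g, hg⟩ := exists_aut_comp_eq (N := induced L C) hM (k.comp i) (induced L C).subtype
  let u : D ↪[L] M := g.toEmbedding.comp k
  have hu : ∀ c : induced L C, u (i c) = c := hg
  refine ⟨range u, finite_range u, fun c hc => ⟨i ⟨c, hc⟩, hu ⟨c, hc⟩⟩, ?_⟩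
  rintro D₁ hfin hD φ hφ ⟨g₁, h₁⟩ ⟨g₂, h₂⟩
  let f : induced L D₁ ≃ induced L (φ '' D₁) := Equiv.Set.imageOfInjOn φ D₁ hφ
  have hf : ∀ x, (f x : M) = φ x := fun _ => rfl
  have huD : ∀ x, u x ∈ induced L D₁ := fun x => hD ⟨x, rfl⟩
  let j₁ : D ↪[L] induced L D₁ := u.codRestrict _ huD
  let j₂ : D ↪[L] induced L (φ '' D₁) := (g₁.toEmbedding.comp u).codRestrict _ fun x =>
    ⟨u x, huD x, (h₁ _ ⟨x, rfl⟩).symm⟩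
  have hj : ∀ x, f (j₁ x) = j₂ x := fun x => Subtype.ext (h₁ _ ⟨x, rfl⟩).symm
  obtain ⟨e, he⟩ := hi _ (mem_age_induced hfin) _ (mem_age_induced (hfin.image φ)) j₁ j₂ f hj (by
    refine (exists_equiv_induced_iff (N := induced L D₁) (P := induced L (φ '' D₁)) f _ _).2
      ⟨fun a => ?_, fun n R x hx => ?_⟩
    · refine not_congr (exists_congr fun c => ?_)
      change j₁ (i c) = a ↔ j₂ (i c) = f a
      rw [← hj, f.apply_eq_iff_eq]
    · have hx' : ∀ i, g₂ (x i) = φ (x i) := fun l => h₂ _ ⟨(x l).2, fun hl =>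
        hx l ⟨⟨x l, hl⟩, Subtype.ext (hu ⟨x l, hl⟩)⟩⟩
      refine (relMap_coe (induced L (φ '' D₁)) R fun l => f (x l)).symm.trans
        (Iff.trans ?_ (relMap_coe (induced L D₁) R x))
      simp only [hf, ← hx']
      exact g₂.map_rel R _)
  have : Finite (induced L D₁) := hfin.to_subtype
  obtain ⟨k', hk'⟩ := exists_aut_comp_eq hM (induced L D₁).subtype
    ((induced L (φ '' D₁)).subtype.comp e.toEmbedding)
  exact ⟨k', fun x hx => (hk' ⟨x, hx⟩).trans (congrArg Subtype.val (he ⟨x, hx⟩))⟩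

lemma exists_not_determines [L.IsRelational] (hM : L.IsUltrahomogeneous M)
    (hs : Splits (L.age M)) :
    ∃ C : Set M, C.Finite ∧ ∀ D, D.Finite → C ⊆ D → ¬ Determines L C D := by
  obtain ⟨C, ⟨hCfg, ⟨k⟩⟩, hC⟩ := hs
  have : Finite C := hCfg.finite
  refine ⟨range k, finite_range k, fun D hDfin hCD hdet => ?_⟩
  obtain ⟨D₁, ⟨hfg₁, ⟨k₁⟩⟩, D₂, ⟨-, ⟨k₂⟩⟩, j₁, j₂, f, hj, he, hne⟩ :=
    hC _ (mem_age_induced hDfin) (k.codRestrict _ fun c => hCD ⟨c, rfl⟩)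
  have : Finite D₁ := hfg₁.finite
  have : Finite (induced L D) := hDfin.to_subtype
  obtain ⟨g, hg⟩ := exists_aut_comp_eq (N := induced L D) hM (k₁.comp j₁) (induced L D).subtype
  obtain ⟨g', hg'⟩ := exists_aut_comp_eq hM (induced L D).subtype (k₂.comp j₂)
  let u : D₁ ↪[L] M := g.toEmbedding.comp k₁
  have hu : ∀ d : induced L D, u (j₁ d) = d := hg
  -- This is `f` transported to `M`; the values off `range u` play no role.
  let φ : M → M := Function.extend u (k₂ ∘ f) id
  have hφ : ∀ x, φ (u x) = k₂ (f x) := fun x => u.injective.extend_apply _ _ x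
  rw [exists_equiv_induced_iff] at he
  obtain ⟨q, hq⟩ := hdet (range u) (finite_range u) (fun d hd => ⟨j₁ ⟨d, hd⟩, hu ⟨d, hd⟩⟩) φ
    (by
      rintro _ ⟨x, rfl⟩ _ ⟨y, rfl⟩ hxy
      rw [hφ, hφ] at hxy
      rw [f.injective (k₂.injective hxy)])
    ⟨g', fun d hd => by
      have h : φ d = k₂ (j₂ ⟨d, hd⟩) :=
        (congrArg φ (hu ⟨d, hd⟩)).symm.trans ((hφ _).trans (congrArg k₂ (hj _)))
      exact (hg' ⟨d, hd⟩).trans h.symm⟩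
    (by
      let T : Set D₁ := u ⁻¹' (range k)ᶜ
      let v : induced L T ↪[L] M :=
        { toFun := fun x => k₂ (f x)
          inj' := fun x y hxy => Subtype.ext (f.injective (k₂.injective hxy))
          map_fun' := fun F => isEmptyElim F
          map_rel' := fun {n} R x => by
            have h := he.2 n R (fun i => (x i : D₁)) fun i => by
              rintro ⟨c, hc⟩
              exact (x i).2 ⟨c, (hu ⟨k c, hCD ⟨c, rfl⟩⟩).symm.trans (congrArg u hc)⟩
            rw [relMap_coe] at h
            exact (k₂.map_rel R fun i => f (x i)).trans h }
      obtain ⟨q, hq⟩ := exists_aut_comp_eq hM (u.comp (induced L T).subtype) v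
      refine ⟨q, ?_⟩
      rintro _ ⟨⟨x, rfl⟩, hx⟩
      rw [hφ]
      exact hq ⟨x, hx⟩)
  refine hne ⟨⟨f, fun F => isEmptyElim F, fun {n} R x => ?_⟩, fun x => rfl⟩
  have h : ∀ x, k₂ (f x) = q (u x) := fun x => (hφ x).symm.trans (hq _ ⟨x, rfl⟩).symm
  refine (k₂.map_rel R _).symm.trans (Iff.trans ?_ ((q.map_rel R _).trans (u.map_rel R x)))
  exact Iff.of_eq (congrArg _ (funext fun i => h (x i)))

/-! ### Back-and-forth limits -/

/-- Limit of a back-and-forth construction of automorphisms. -/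
lemma exists_aut_of_backAndForth [L.IsRelational] [Countable M]
    (Good : Set M → (M ≃[L] M) → Prop)
    (forth : ∀ S g, S.Finite → Good S g → ∀ x, ∃ S' g', S'.Finite ∧ S ⊆ S' ∧ Good S' g' ∧
      (∀ y ∈ S, g' y = g y) ∧ x ∈ S')
    (back : ∀ S g, S.Finite → Good S g → ∀ x, ∃ S' g', S'.Finite ∧ S ⊆ S' ∧ Good S' g' ∧
      (∀ y ∈ S, g' y = g y) ∧ ∃ y ∈ S', g' y = x)
    {S₀ : Set M} {g₀ : M ≃[L] M} (hfin : S₀.Finite) (h₀ : Good S₀ g₀) :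
    ∃ h : M ≃[L] M, (∀ x ∈ S₀, h x = g₀ x) ∧ ∀ x, ∃ S g, Good S g ∧ x ∈ S ∧ h x = g x := by
  rcases isEmpty_or_nonempty M with hM | hM
  · exact ⟨g₀, fun _ _ => rfl, fun x => isEmptyElim x⟩
  let P := {p : Set M × (M ≃[L] M) // p.1.Finite ∧ Good p.1 p.2}
  have step : ∀ (p : P) (x : M), ∃ q : P, p.1.1 ⊆ q.1.1 ∧ (∀ y ∈ p.1.1, q.1.2 y = p.1.2 y) ∧
      x ∈ q.1.1 ∧ ∃ y ∈ q.1.1, q.1.2 y = x := by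
    rintro ⟨⟨S, g⟩, hS, hg⟩ x
    obtain ⟨S₁, g₁, hS₁, hsub₁, hg₁, hag₁, hx₁⟩ := forth S g hS hg x
    obtain ⟨S₂, g₂, hS₂, hsub₂, hg₂, hag₂, y, hy, hyx⟩ := back S₁ g₁ hS₁ hg₁ x
    exact ⟨⟨⟨S₂, g₂⟩, hS₂, hg₂⟩, hsub₁.trans hsub₂,
      fun y hy => (hag₂ y (hsub₁ hy)).trans (hag₁ y hy), hsub₂ hx₁, y, hy, hyx⟩
  choose next hsub hag hmem hsurj using step
  obtain ⟨e, he⟩ := exists_surjective_nat M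
  let p : ℕ → P := fun n => Nat.rec ⟨⟨S₀, g₀⟩, hfin, h₀⟩ (fun n q => next q (e n)) n
  have hp : ∀ n, p (n + 1) = next (p n) (e n) := fun _ => rfl
  have hmono : Monotone fun n => (p n).1.1 :=
    monotone_nat_of_le_succ fun n => by rw [hp]; exact hsub _ _
  have hagree : ∀ m n, m ≤ n → ∀ x ∈ (p m).1.1, (p n).1.2 x = (p m).1.2 x := by
    intro m n hmn x hx
    induction n, hmn using Nat.le_induction with
    | base => rfl
    | succ n hmn ih => rw [hp, hag _ _ _ (hmono hmn hx), ih]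
  have hex : ∀ x, ∃ n, x ∈ (p n).1.1 := fun x => by
    obtain ⟨n, rfl⟩ := he x
    exact ⟨n + 1, hmem _ _⟩
  choose N hN using hex
  let F : M → M := fun x => (p (N x)).1.2 x
  have hF : ∀ n, ∀ x ∈ (p n).1.1, F x = (p n).1.2 x := by
    intro n x hx
    rcases le_total n (N x) with h | h
    · exact hagree _ _ h x hx
    · exact (hagree _ _ h x (hN x)).symm
  have hinj : Function.Injective F := by
    intro x y hxy
    have hx := hmono (le_max_left (N x) (N y)) (hN x)
    have hy := hmono (le_max_right (N x) (N y)) (hN y)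
    rw [hF _ x hx, hF _ y hy] at hxy
    exact (p _).1.2.injective hxy
  have hsur : Function.Surjective F := by
    intro x
    obtain ⟨n, rfl⟩ := he x
    obtain ⟨y, hy, hyx⟩ := hsurj (p n) (e n)
    exact ⟨y, (hF (n + 1) y hy).trans hyx⟩
  refine ⟨⟨Equiv.ofBijective F ⟨hinj, hsur⟩, fun f => isEmptyElim f, fun {n} R x => ?_⟩,
    fun x hx => hF 0 x hx, fun x => ⟨_, _, (p (N x)).2.2, hN x, rfl⟩⟩
  obtain ⟨m, hm⟩ : ∃ m, ∀ i, N (x i) ≤ m :=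
    ⟨Finset.univ.sup fun i => N (x i), fun i => Finset.le_sup (f := fun i => N (x i))
      (Finset.mem_univ i)⟩
  have h : (Equiv.ofBijective F ⟨hinj, hsur⟩ : M → M) ∘ x = (p m).1.2 ∘ x :=
    funext fun i => hF m _ (hmono (hm i) (hN (x i)))
  exact h ▸ (p m).1.2.map_rel R x

/-! ### Generic colorings -/

/-- Every one-point type over a finite set is realized by points of both colors of `χ`. -/
def RealizesTypes (L : FirstOrder.Language.{u, v}) [L.Structure M] (χ : M → Bool) : Prop :=
  ∀ X : Set M, X.Finite → ∀ a ∉ X, ∀ ε, ∃ g : M ≃[L] M, (∀ x ∈ X, g x = x) ∧ χ (g a) = ε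

lemma eventually_realizesTypes [Countable M] (hM : NoAlgebraicity L M) :
    ∀ᶠ χ : M → Bool in residual (M → Bool), RealizesTypes L χ := by
  have key : ∀ (X : Finset M) (a : M) (ε : Bool), ∀ᶠ χ : M → Bool in residual (M → Bool),
      a ∉ X → ∃ g : M ≃[L] M, (∀ x ∈ X, g x = x) ∧ χ (g a) = ε := by
    intro X a ε
    by_cases ha : a ∈ X
    · exact Filter.Eventually.of_forall fun χ h => absurd ha h
    have hopen : IsOpen {χ : M → Bool | ∃ g : M ≃[L] M, (∀ x ∈ X, g x = x) ∧ χ (g a) = ε} := by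
      have : {χ : M → Bool | ∃ g : M ≃[L] M, (∀ x ∈ X, g x = x) ∧ χ (g a) = ε} =
          ⋃ g : {g : M ≃[L] M // ∀ x ∈ X, g x = x}, (fun χ : M → Bool => χ (g.1 a)) ⁻¹' {ε} := by
        ext χ
        simp
      rw [this]
      exact isOpen_iUnion fun g => (isOpen_discrete _).preimage (continuous_apply _)
    refine Filter.mem_of_superset (residual_of_dense_open hopen ?_) fun χ h _ => h
    rw [dense_iff_inter_open]
    rintro U hU ⟨χ, hχ⟩
    obtain ⟨I, W, hW, hIU⟩ := isOpen_pi_iff.1 hU χ hχ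
    -- A basic open set constrains only the finitely many colors on `I`; the infinite orbit contains
    -- a point outside `I`, free to be recolored.
    obtain ⟨b, ⟨g, hg, rfl⟩, hb⟩ := (hM X a ha).exists_notMem_finset I
    classical
    refine ⟨Function.update χ (g a) ε, hIU fun i hi => ?_, g, hg, by simp⟩
    rw [Function.update_of_ne (fun h : i = g a => hb (h ▸ hi))]
    exact (hW i hi).2
  have h := eventually_countable_forall.2 fun X => eventually_countable_forall.2 fun a =>
    eventually_countable_forall.2 (key X a)
  filter_upwards [h] with χ hχ X hX a ha ε
  simpa using hχ hX.toFinset a ε (by simpa using ha)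

/-- A finite set can be moved into prescribed colors over a disjoint finite set. -/
lemma RealizesTypes.exists_recolor {χ : M → Bool} (hχ : RealizesTypes L χ) {S T : Set M}
    (hS : S.Finite) (hT : T.Finite) (hST : Disjoint S T) (ε : Bool) (g : M ≃[L] M) :
    ∃ g' : M ≃[L] M, (∀ x ∈ S, g' x = g x) ∧ ∀ x ∈ T, χ (g' x) = ε := by
  induction T, hT using Set.Finite.induction_on with
  | empty => exact ⟨g, fun _ _ => rfl, fun x hx => hx.elim⟩
  | @insert a T ha hT ih =>
    rw [disjoint_insert_right] at hST
    obtain ⟨g', hg', hT'⟩ := ih hST.2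
    obtain ⟨k, hk, hka⟩ := hχ (g' '' (S ∪ T)) ((hS.union hT).image _) (g' a) (by
      rintro ⟨y, hy, hya⟩
      rw [g'.injective hya] at hy
      exact hy.elim hST.1 ha) ε
    refine ⟨k.comp g', fun x hx => ?_, ?_⟩
    · exact (hk _ ⟨x, .inl hx, rfl⟩).trans (hg' x hx)
    · rintro x (rfl | hx)
      · exact hka
      · exact (congrArg χ (hk _ ⟨x, .inr hx, rfl⟩)).trans (hT' x hx)

/-- Finite color-preserving partial isomorphisms extend to color-preserving automorphisms. -/
lemma RealizesTypes.exists_aut [L.IsRelational] [Countable M] {χ χ' : M → Bool}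
    (hχ : RealizesTypes L χ) (hχ' : RealizesTypes L χ') {S : Set M} (hS : S.Finite)
    {g : M ≃[L] M} (hg : ∀ x ∈ S, χ' (g x) = χ x) :
    ∃ h : M ≃[L] M, (∀ x ∈ S, h x = g x) ∧ ∀ x, χ' (h x) = χ x := by
  suffices H : ∃ h : M ≃[L] M, (∀ x ∈ S, h x = g x) ∧
      ∀ x, ∃ (S : Set M) (g : M ≃[L] M), (∀ x ∈ S, χ' (g x) = χ x) ∧ x ∈ S ∧
        h x = g x by
    obtain ⟨h, h₁, h₂⟩ := H
    refine ⟨h, h₁, fun x => ?_⟩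
    obtain ⟨S, g, hg, hx, hxg⟩ := h₂ x
    rw [hxg, hg x hx]
  refine exists_aut_of_backAndForth (fun S g => ∀ x ∈ S, χ' (g x) = χ x)
    (fun S g hS hg x => ?_) (fun S g hS hg x => ?_) hS hg
  · by_cases hx : x ∈ S
    · exact ⟨S, g, hS, Subset.rfl, hg, fun _ _ => rfl, hx⟩
    obtain ⟨g', hg', hc⟩ := hχ'.exists_recolor hS (finite_singleton x)
      (disjoint_singleton_right.2 hx) (χ x) g
    refine ⟨insert x S, g', hS.insert x, subset_insert _ _, ?_, hg', mem_insert _ _⟩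
    rintro y (rfl | hy)
    · exact hc _ rfl
    · rw [hg' y hy, hg y hy]
  · by_cases hx : g.symm x ∈ S
    · exact ⟨S, g, hS, Subset.rfl, hg, fun _ _ => rfl, _, hx, g.apply_symm_apply x⟩
    obtain ⟨k, hk, hc⟩ := hχ.exists_recolor (hS.image g) (finite_singleton x)
      (disjoint_singleton_right.2 (by
        rintro ⟨y, hy, rfl⟩
        exact hx (by simpa using hy))) (χ' x) g.symm
    have hk' : ∀ y ∈ S, k.symm y = g y := fun y hy => by
      rw [← k.injective.eq_iff, k.apply_symm_apply, hk _ ⟨y, hy, rfl⟩, g.symm_apply_apply]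
    refine ⟨insert (k x) S, k.symm, hS.insert _, subset_insert _ _, ?_, hk', k x,
      mem_insert _ _, k.symm_apply_apply x⟩
    rintro y (rfl | hy)
    · rw [k.symm_apply_apply, hc x rfl]
    · rw [hk' y hy, hg y hy]

lemma exists_equiv_of_aut [L.IsRelational] {χ χ' : M → Bool} (g : M ≃[L] M)
    (hg : ∀ x, χ' (g x) = χ x) : ∃ h : ofChar L χ ≃[L] ofChar L χ', ∀ a, (h a : M) = g a :=
  (exists_equiv_induced_iff g.toEquiv {x | χ x = true} {x | χ' x = true}).2
    ⟨fun a => Eq.congr_left (hg a).symm, fun _ R x _ => g.map_rel R x⟩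

lemma mem_ofChar [L.IsRelational] {χ : M → Bool} {x : M} : x ∈ ofChar L χ ↔ χ x = true := Iff.rfl

/-- An automorphism fixing `C` pointwise can push the rest of `D` into the substructure, and
`Determines` is invariant under automorphisms. -/
lemma RealizesTypes.exists_determines {χ : M → Bool} (hχ : RealizesTypes L χ)
    (hdet : ∀ C : Set M, C.Finite → ∃ D, D.Finite ∧ C ⊆ D ∧ Determines L C D) {C : Set M}
    (hC : C.Finite) :
    ∃ D, D.Finite ∧ C ⊆ D ∧ (∀ y ∈ D, y ∉ C → χ y = true) ∧ Determines L C D := by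
  obtain ⟨D, hD, hCD, hdet⟩ := hdet C hC
  obtain ⟨k, hk, hkD⟩ := hχ.exists_recolor hC (hD.sdiff (t := C)) disjoint_sdiff_right true
    (Language.Equiv.refl L M)
  have hkC : k '' C = C := (image_congr hk).trans (image_id C)
  refine ⟨k '' D, hD.image k, hkC ▸ image_mono hCD, ?_, ?_⟩
  · rintro _ ⟨y, hy, rfl⟩ hyC
    exact hkD y ⟨hy, fun h => hyC (hkC ▸ ⟨y, h, rfl⟩)⟩
  · have := hdet.image k
    rwa [hkC] at this

/-! ### Non-splitting: extending isomorphisms -/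

section Relational

variable [L.IsRelational] {χ χ' : M → Bool}

/-- The union of `h` and the restriction of `γ` to `S` is, on every finite set, the restriction of
an automorphism. -/
def Compatible (h : ofChar L χ ≃[L] ofChar L χ') (S : Set M) (γ : M → M) : Prop :=
  ∀ F : Set M, F.Finite → ∃ g : M ≃[L] M, (∀ x ∈ S, g x = γ x) ∧
    ∀ a : ofChar L χ, (a : M) ∈ F → g a = h a

variable {h : ofChar L χ ≃[L] ofChar L χ'} {S : Set M}

lemma Compatible.apply_eq {γ : M → M} (hc : Compatible h S γ) (a : ofChar L χ)
    (ha : (a : M) ∈ S) : γ a = h a := by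
  obtain ⟨g, h₁, h₂⟩ := hc {(a : M)} (finite_singleton _)
  rw [← h₁ _ ha, h₂ a rfl]

lemma Compatible.color_eq {γ : M → M} (hc : Compatible h S γ) {c : M} (hcS : c ∈ S) :
    χ' (γ c) = χ c := by
  rw [Bool.eq_iff_iff]
  refine ⟨fun hγ => ?_, fun hχ => ?_⟩
  · let a : ofChar L χ := h.symm ⟨γ c, hγ⟩
    obtain ⟨g, h₁, h₂⟩ := hc {(a : M)} (finite_singleton _)
    have h₃ : g a = g c := by
      rw [h₂ a rfl, h₁ c hcS, h.apply_symm_apply]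
    rw [← g.injective h₃]
    exact a.2
  · rw [hc.apply_eq ⟨c, hχ⟩ hcS]
    exact (h ⟨c, hχ⟩).2

/-- This turns each back step into a forth step for `h.symm`. -/
lemma Compatible.symm {g : M ≃[L] M} (hc : Compatible h S g) :
    Compatible h.symm (g '' S) g.symm := by
  intro F hF
  obtain ⟨g', h₁, h₂⟩ := hc ((fun b : ofChar L χ' => (h.symm b : M)) '' ((↑) ⁻¹' F))
    ((hF.preimage Subtype.val_injective.injOn).image _)
  refine ⟨g'.symm, ?_, fun b hb => ?_⟩
  · rintro _ ⟨x, hx, rfl⟩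
    rw [← h₁ x hx, g'.symm_apply_apply, ← g.injective.eq_iff, g.apply_symm_apply, h₁ x hx]
  · have := h₂ (h.symm b) ⟨b, hb, rfl⟩
    rw [h.apply_symm_apply] at this
    rw [← this, g'.symm_apply_apply]

lemma compatible_empty (hM : L.IsUltrahomogeneous M) (h : ofChar L χ ≃[L] ofChar L χ')
    (γ : M → M) : Compatible h ∅ γ := by
  intro F hF
  have : Finite (induced L (F ∩ {x | χ x = true})) := (hF.inter_of_left _).to_subtype
  have hle : induced L (F ∩ {x | χ x = true}) ≤ ofChar L χ := fun x hx => hx.2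
  obtain ⟨g, hg⟩ := exists_aut_comp_eq hM (induced L (F ∩ {x | χ x = true})).subtype
    ((ofChar L χ').subtype.comp (h.toEmbedding.comp (Substructure.inclusion hle)))
  exact ⟨g, fun x hx => hx.elim, fun a ha => hg ⟨a, ha, a.2⟩⟩

lemma Compatible.exists_insert (hχ : RealizesTypes L χ) (hχ' : RealizesTypes L χ')
    (hdet : ∀ C : Set M, C.Finite → ∃ D, D.Finite ∧ C ⊆ D ∧ Determines L C D)
    (hS : S.Finite) {g : M ≃[L] M} (hc : Compatible h S g) (x : M) :
    ∃ g' : M ≃[L] M, (∀ y ∈ S, g' y = g y) ∧ Compatible h (insert x S) g' := by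
  by_cases hxS : x ∈ S
  · exact ⟨g, fun _ _ => rfl, by rwa [insert_eq_of_mem hxS]⟩
  by_cases hx : x ∈ ofChar L χ
  · obtain ⟨g', h₁, h₂⟩ := hc {x} (finite_singleton x)
    refine ⟨g', h₁, fun F hF => ?_⟩
    obtain ⟨q, hq₁, hq₂⟩ := hc (insert x F) (hF.insert x)
    refine ⟨q, ?_, fun a ha => hq₂ a (.inr ha)⟩
    rintro y (rfl | hy)
    · rw [hq₂ ⟨y, hx⟩ (.inl rfl), h₂ ⟨y, hx⟩ rfl]
    · rw [hq₁ y hy, h₁ y hy]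
  have hxC : x ∈ insert x S \ {y | χ y = true} := ⟨mem_insert _ _, hx⟩
  obtain ⟨D, hD, hCD, hDχ, hdetD⟩ := hχ.exists_determines hdet
    (C := insert x S \ {y | χ y = true}) (hS.insert x).sdiff
  obtain ⟨g', hg', hg'h⟩ := hc (S ∪ D) (hS.union hD)
  -- The image of `x` must avoid the target substructure, whose points are already values of `h`.
  obtain ⟨g'', hg'', hg''x⟩ := hχ'.exists_recolor (S := (S ∪ D) \ {x})
    (hS.union hD).sdiff (finite_singleton x) disjoint_sdiff_left false g'
  have hne : ∀ a : ofChar L χ, (a : M) ≠ x := fun a ha => hx (ha ▸ a.2)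
  have hgg : ∀ y ∈ S, g'' y = g y := fun y hy => by
    rw [hg'' y ⟨.inl hy, fun hyx => hxS (hyx ▸ hy)⟩, hg' y hy]
  have hgh : ∀ a : ofChar L χ, (a : M) ∈ S ∪ D → g'' a = h a := fun a ha => by
    rw [hg'' a ⟨ha, hne a⟩, hg'h a ha]
  have hgC : ∀ y ∈ insert x S \ {y | χ y = true}, χ' (g'' y) = false := by
    rintro y ⟨rfl | hy, hyχ⟩
    · exact hg''x y rfl
    · rw [hgg y hy, hc.color_eq hy]
      simpa using hyχ
  refine ⟨g'', hgg, fun F hF => ?_⟩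
  classical
  let φ : M → M := fun y => if hy : y ∈ ofChar L χ then h ⟨y, hy⟩ else g'' y
  have hφ : ∀ a : ofChar L χ, φ a = h a := fun a => dif_pos a.2
  have hφ' : ∀ y, y ∉ ofChar L χ → φ y = g'' y := fun y hy => dif_neg hy
  let D₁ : Set M := D ∪ (F ∪ S) ∩ {y | χ y = true}
  have hD₁ : D₁.Finite := hD.union ((hF.union hS).inter_of_left _)
  have hD₁C : ∀ y ∈ D₁, y ∉ ofChar L χ → y ∈ insert x S \ {y | χ y = true} := by
    rintro y (hy | hy) hyχ
    · exact not_not.1 fun hyC => hyχ (hDχ y hy hyC)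
    · exact absurd hy.2 hyχ
  have hφχ : ∀ y ∈ D₁, χ' (φ y) = χ y := by
    intro y hy
    by_cases hyχ : y ∈ ofChar L χ
    · rw [hφ ⟨y, hyχ⟩, mem_ofChar.1 hyχ]
      exact (h ⟨y, hyχ⟩).2
    · rw [hφ' y hyχ, hgC y (hD₁C y hy hyχ)]
      simpa [mem_ofChar] using hyχ
  obtain ⟨q, hq⟩ := hdetD D₁ hD₁ subset_union_left φ (by
      intro y hy z hz hyz
      have hcol : χ y = χ z := by rw [← hφχ y hy, hyz, hφχ z hz]
      by_cases hyχ : y ∈ ofChar L χ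
      · have hzχ : z ∈ ofChar L χ := mem_ofChar.2 (hcol ▸ hyχ)
        rw [hφ ⟨y, hyχ⟩, hφ ⟨z, hzχ⟩] at hyz
        exact congrArg Subtype.val (h.injective (Subtype.ext hyz))
      · have hzχ : z ∉ ofChar L χ := fun hz => hyχ (mem_ofChar.2 (hcol.trans hz))
        rw [hφ' y hyχ, hφ' z hzχ] at hyz
        exact g''.injective hyz)
    ⟨g'', fun y hy => by
      by_cases hyχ : y ∈ ofChar L χ
      · rw [hφ ⟨y, hyχ⟩, hgh ⟨y, hyχ⟩ (.inr hy)]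
      · rw [hφ' y hyχ]⟩
    -- Off `C`, all of `D₁` lies in the substructure, so `φ` is `h` there and compatibility of `h`
    -- supplies the automorphism.
    (by
      obtain ⟨q, -, hq⟩ := hc D₁ hD₁
      refine ⟨q, fun y hy => ?_⟩
      have hyχ : y ∈ ofChar L χ := not_not.1 fun hyχ => hy.2 (hD₁C y hy.1 hyχ)
      rw [hφ ⟨y, hyχ⟩, hq ⟨y, hyχ⟩ hy.1])
  have hqh : ∀ a : ofChar L χ, (a : M) ∈ F ∪ S → q a = h a := fun a ha => by
    rw [hq a (.inr ⟨ha, a.2⟩), hφ a]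
  refine ⟨q, fun y hy => ?_, fun a ha => hqh a (.inl ha)⟩
  by_cases hyχ : y ∈ ofChar L χ
  · have hyS : y ∈ S := hy.resolve_left (hne ⟨y, hyχ⟩)
    rw [hqh ⟨y, hyχ⟩ (.inr hyS), hgh ⟨y, hyχ⟩ (.inl hyS)]
  · rw [hq y (.inl (hCD ⟨hy, hyχ⟩)), hφ' y hyχ]

/-- If finite sets are determined over their complements, then all isomorphisms between
substructures realizing all types extend. -/
lemma extendable_eq_univ [Countable M] (hM : L.IsUltrahomogeneous M) (hχ : RealizesTypes L χ)
    (hχ' : RealizesTypes L χ')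
    (hdet : ∀ C : Set M, C.Finite → ∃ D, D.Finite ∧ C ⊆ D ∧ Determines L C D) :
    extendable (ofChar L χ) (ofChar L χ') = univ := by
  refine eq_univ_of_forall fun h => ?_
  suffices H : ∃ g : M ≃[L] M, (∀ x ∈ (∅ : Set M), g x = Language.Equiv.refl L M x) ∧
      ∀ x, ∃ (S : Set M) (g' : M ≃[L] M), Compatible h S g' ∧ x ∈ S ∧ g x = g' x by
    obtain ⟨g, -, hg⟩ := H
    refine ⟨g, fun a => ?_⟩
    obtain ⟨S, g', hc, ha, hgg'⟩ := hg a
    rw [hgg', hc.apply_eq a ha]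
  refine exists_aut_of_backAndForth (fun S g => Compatible h S g)
    (fun S g hS hc x => ?_) (fun S g hS hc x => ?_) finite_empty (compatible_empty hM h _)
  · obtain ⟨g', hg', hc'⟩ := hc.exists_insert hχ hχ' hdet hS x
    exact ⟨insert x S, g', hS.insert x, subset_insert _ _, hc', hg', mem_insert _ _⟩
  · obtain ⟨k, hk, hc'⟩ := hc.symm.exists_insert hχ' hχ hdet (hS.image g) x
    have hks : ∀ y ∈ S, k.symm y = g y := fun y hy => by
      rw [← k.injective.eq_iff, k.apply_symm_apply, hk _ ⟨y, hy, rfl⟩, g.symm_apply_apply]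
    have him : k '' insert x (g '' S) = insert (k x) S := by
      rw [image_insert_eq, image_image]
      congr 1
      exact (image_congr fun y hy =>
        (hk _ ⟨y, hy, rfl⟩).trans (g.symm_apply_apply y)).trans (image_id S)
    refine ⟨insert (k x) S, k.symm, hS.insert _, subset_insert _ _, ?_, hks, k x,
      mem_insert _ _, k.symm_apply_apply x⟩
    rw [← him]
    exact hc'.symm

lemma nonempty_equiv [Countable M] (hχ : RealizesTypes L χ) (hχ' : RealizesTypes L χ') :
    Nonempty (ofChar L χ ≃[L] ofChar L χ') := by
  obtain ⟨g, -, hg⟩ := hχ.exists_aut hχ' finite_empty (g := Language.Equiv.refl L M)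
    fun x hx => hx.elim
  exact ⟨(exists_equiv_of_aut g hg).choose⟩

end Relational
-- Splitting: meagerness
lemma isOpen_setOf_agree {N : Type w} {P : Type w'} [L.Structure N] [L.Structure P]
    (h : N ≃[L] P) {F : Set N} (hF : F.Finite) : IsOpen {h' : N ≃[L] P | ∀ a ∈ F, h' a = h a} := by
  let _ : TopologicalSpace P := ⊥
  have : DiscreteTopology P := ⟨rfl⟩
  exact isOpen_induced_iff.2 ⟨F.pi fun a => {h a},
    isOpen_set_pi hF fun a _ => isOpen_discrete _, rfl⟩

lemma exists_setOf_agree_subset {N : Type w} {P : Type w'} [L.Structure N] [L.Structure P]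
    {U : Set (N ≃[L] P)} (hU : IsOpen U) {h : N ≃[L] P} (h_mem : h ∈ U) :
    ∃ F : Set N, F.Finite ∧ {h' : N ≃[L] P | ∀ a ∈ F, h' a = h a} ⊆ U := by
  let _ : TopologicalSpace P := ⊥
  obtain ⟨V, hV, rfl⟩ := isOpen_induced_iff.1 hU
  obtain ⟨I, W, hW, hIV⟩ := isOpen_pi_iff.1 hV _ h_mem
  refine ⟨I, I.finite_toSet, fun h' hh' => hIV fun a ha => ?_⟩
  change h' a ∈ W a
  rw [hh' a ha]
  exact (hW a ha).2

variable [L.IsRelational] {χ χ' : M → Bool}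

/-- Near an isomorphism compatible with `γ` there is an isomorphism that is not. -/
lemma Compatible.exists_agree_not_compatible [Countable M] (hχ : RealizesTypes L χ)
    (hχ' : RealizesTypes L χ') {C : Set M} (hC : C.Finite) (hCχ : ∀ c ∈ C, χ c = false)
    (hdet : ∀ D, D.Finite → C ⊆ D → ¬ Determines L C D) {h : ofChar L χ ≃[L] ofChar L χ'}
    {γ : M → M} (hc : Compatible h C γ) {F : Set (ofChar L χ)} (hF : F.Finite) :
    ∃ h' : ofChar L χ ≃[L] ofChar L χ', (∀ a ∈ F, h' a = h a) ∧ ¬ Compatible h' C γ := by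
  let F' : Set M := (↑) '' F
  have hF' : F'.Finite := hF.image _
  obtain ⟨g, hgC, hgF⟩ := hc F' hF'
  have hnd := hdet (C ∪ F') (hC.union hF') subset_union_left
  unfold Determines at hnd
  push Not at hnd
  obtain ⟨D₁, hD₁, hD, φ, hφ, ⟨q₀, hq₀⟩, ⟨q₁, hq₁⟩, hne⟩ := hnd
  -- normalize `φ` so that it agrees with `g` on `C ∪ F'`
  let t : M ≃[L] M := g.comp q₀.symm
  have htφ : ∀ x ∈ C ∪ F', t (φ x) = g x := fun x hx => by
    rw [← hq₀ x hx]
    exact congrArg g (q₀.symm_apply_apply x)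
  -- move the new points of the domain and of the range into the substructures
  obtain ⟨k₁, hk₁, hk₁χ⟩ := hχ.exists_recolor (hC.union hF') (hD₁.sdiff (t := C ∪ F'))
    disjoint_sdiff_right true (Language.Equiv.refl L M)
  obtain ⟨k₂, hk₂, hk₂χ⟩ := hχ'.exists_recolor (S := φ '' (C ∪ F')) (T := φ '' (D₁ \ (C ∪ F')))
    ((hC.union hF').image φ) (hD₁.sdiff.image φ)
    (disjoint_left.2 (by
      rintro _ ⟨x, hx, rfl⟩ ⟨y, hy, hyx⟩
      exact hy.2 (hφ hy.1 (hD hx) hyx ▸ hx))) true t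
  have hCF : ∀ a ∈ F', a ∉ C := by
    rintro _ ⟨a, -, rfl⟩ haC
    exact Bool.false_ne_true ((hCχ _ haC).symm.trans a.2)
  have hk₁' : ∀ x ∈ C ∪ F', k₁ x = x := hk₁
  have hk₂' : ∀ x ∈ C ∪ F', k₂ (φ x) = g x := fun x hx => by rw [hk₂ _ ⟨x, hx, rfl⟩, htφ x hx]
  have hr : ∀ x ∈ D₁ \ C, k₂ (q₁ (k₁.symm (k₁ x))) = k₂ (φ x) := fun x hx => by
    rw [k₁.symm_apply_apply, hq₁ x hx]
  have hk₁D : ∀ x ∈ D₁ \ C, χ (k₁ x) = true := fun x hx => by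
    by_cases hxF : x ∈ F'
    · rw [hk₁' x (.inr hxF)]
      obtain ⟨a, -, rfl⟩ := hxF
      exact a.2
    · exact hk₁χ x ⟨hx.1, fun h => h.elim hx.2 hxF⟩
  have hk₂D : ∀ x ∈ D₁ \ C, χ' (k₂ (φ x)) = true := fun x hx => by
    by_cases hxF : x ∈ F'
    · rw [hk₂' x (.inr hxF)]
      obtain ⟨a, -, rfl⟩ := id hxF
      rw [hgF a hxF]
      exact (h a).2
    · exact hk₂χ _ ⟨x, ⟨hx.1, fun h => h.elim hx.2 hxF⟩, rfl⟩
  -- The map `k₁ x ↦ k₂ (φ x)` on `D₁ \ C` goes between the two substructures, so it extends to a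
  -- color-preserving automorphism. Compatibility of the resulting `h'` with `γ` would make `φ`
  -- extend on all of `D₁`.
  obtain ⟨g', hg', hg'χ⟩ := hχ.exists_aut hχ' ((hD₁.sdiff (t := C)).image k₁)
    (g := (k₂.comp q₁).comp k₁.symm) (by
      rintro _ ⟨x, hx, rfl⟩
      rw [hk₁D x hx, ← hk₂D x hx]
      exact congrArg χ' (hr x hx))
  have hg'' : ∀ x ∈ D₁ \ C, g' (k₁ x) = k₂ (φ x) := fun x hx =>
    (hg' _ ⟨x, hx, rfl⟩).trans (hr x hx)
  obtain ⟨h', hh'⟩ := exists_equiv_of_aut g' hg'χ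
  refine ⟨h', fun a ha => Subtype.ext ?_, fun hc' => hne ?_⟩
  · have haF : (a : M) ∈ F' := ⟨a, ha, rfl⟩
    have h₁ := hg'' a ⟨hD (.inr haF), hCF a haF⟩
    rw [hk₁' _ (.inr haF), hk₂' _ (.inr haF), hgF a haF] at h₁
    rw [hh', h₁]
  · obtain ⟨r, hrC, hrD⟩ := hc' (k₁ '' (D₁ \ C)) (hD₁.sdiff.image k₁)
    have hrk : ∀ x ∈ D₁, r (k₁ x) = k₂ (φ x) := fun x hx => by
      by_cases hxC : x ∈ C
      · rw [hk₁' x (.inl hxC), hk₂' x (.inl hxC), hrC x hxC, hgC x hxC]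
      · rw [← hg'' x ⟨hx, hxC⟩, hrD ⟨k₁ x, hk₁D x ⟨hx, hxC⟩⟩ ⟨x, ⟨hx, hxC⟩, rfl⟩, hh']
    exact ⟨(k₂.symm.comp r).comp k₁, fun x hx =>
      (congrArg k₂.symm (hrk x hx)).trans (k₂.symm_apply_apply _)⟩

/-- A failure of compatibility is witnessed on one finite set, hence persists nearby. -/
lemma isClosed_setOf_compatible (C : Set M) (γ : M → M) :
    IsClosed {h : ofChar L χ ≃[L] ofChar L χ' | Compatible h C γ} := by
  rw [← isOpen_compl_iff, isOpen_iff_forall_mem_open]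
  intro h hh
  simp only [mem_compl_iff, mem_ofPred_eq, Compatible, not_forall] at hh
  obtain ⟨F, hF, hne⟩ := hh
  refine ⟨_, ?_, isOpen_setOf_agree h (F := (↑) ⁻¹' F) (hF.preimage Subtype.val_injective.injOn),
    fun _ _ => rfl⟩
  intro h' hh' hc
  obtain ⟨g, hg₁, hg₂⟩ := hc F hF
  exact hne ⟨g, hg₁, fun a ha => by rw [hg₂ a ha, hh' a ha]⟩

lemma isMeagre_extendable [Countable M] (hχ : RealizesTypes L χ)
    (hχ' : RealizesTypes L χ') {C : Set M} (hC : C.Finite)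
    (hdet : ∀ D, D.Finite → C ⊆ D → ¬ Determines L C D) :
    IsMeagre (extendable (ofChar L χ) (ofChar L χ')) := by
  wlog hCχ : ∀ c ∈ C, χ c = false generalizing C
  · obtain ⟨k, -, hk⟩ := hχ.exists_recolor finite_empty hC (empty_disjoint C) false
      (Language.Equiv.refl L M)
    refine this (hC.image k) (fun D hD hCD hdetD => ?_) (by rintro _ ⟨c, hc, rfl⟩; exact hk c hc)
    have h := hdetD.image k.symm
    have him : k.symm '' (k '' C) = C := by
      rw [image_image]
      exact (image_congr fun x _ => k.symm_apply_apply x).trans (image_id C)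
    rw [him] at h
    exact hdet _ (hD.image _) (him ▸ image_mono hCD) h
  have : Finite C := hC.to_subtype
  -- The union is countable because `C` is finite and `M` countable; an extension `g` of `h` makes
  -- `h` compatible with the restriction of `g` to `C`.
  refine IsMeagre.mono (s := ⋃ γ : C → M, {h : ofChar L χ ≃[L] ofChar L χ' |
    Compatible h C (Function.extend Subtype.val γ id)}) ?_ (isMeagre_iUnion fun γ => ?_)
  · rintro h ⟨g, hg⟩
    refine mem_iUnion.2 ⟨fun c => g c, fun F _ => ⟨g, fun x hx => ?_, fun a _ => hg a⟩⟩
    exact (Subtype.val_injective.extend_apply (fun c : C => g c) id ⟨x, hx⟩).symm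
  · refine IsNowhereDense.isMeagre ((isClosed_setOf_compatible C _).isNowhereDense_iff.2 ?_)
    refine eq_empty_of_forall_notMem fun h hh => ?_
    obtain ⟨F, hF, hFU⟩ := exists_setOf_agree_subset isOpen_interior hh
    obtain ⟨h', hh', hne⟩ := Compatible.exists_agree_not_compatible hχ hχ' hC hCχ hdet
      (interior_subset hh) hF
    exact hne (interior_subset (hFU hh'))

lemma eventually_pair {X : Type*} [TopologicalSpace X] {p : X → Prop}
    (hp : ∀ᶠ x in residual X, p x) : ∀ᶠ z : X × X in residual (X × X), p z.1 ∧ p z.2 := by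
  have h : IsMeagre {x | p x}ᶜ := by
    rw [IsMeagre, compl_compl]
    exact hp
  have h₁ := h.preimage_of_isOpenMap (f := (Prod.fst : X × X → X)) continuous_fst isOpenMap_fst
  have h₂ := h.preimage_of_isOpenMap (f := (Prod.snd : X × X → X)) continuous_snd isOpenMap_snd
  simp only [IsMeagre, preimage_compl, compl_compl] at h₁ h₂
  filter_upwards [h₁, h₂] with z hz₁ hz₂ using ⟨hz₁, hz₂⟩

end GenericSubstructure

theorem mainTheorem1 {L : FirstOrder.Language.{u, v}} [L.IsRelational] [Countable L.Symbols]
    {M : Type w} [L.Structure M] [Countable M] [Infinite M]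
    (hM : L.IsUltrahomogeneous M) (hM' : GenericSubstructure.NoAlgebraicity L M) :
    (GenericSubstructure.Splits (L.age M) →
      (∀ᶠ χ : M → Bool in residual (M → Bool),
        GenericSubstructure.IsStronglyNonGlobal (GenericSubstructure.ofChar L χ)) ∧
      (∀ᶠ p : (M → Bool) × (M → Bool) in residual ((M → Bool) × (M → Bool)),
        GenericSubstructure.IsStronglyNonGlobalPair
          (GenericSubstructure.ofChar L p.1) (GenericSubstructure.ofChar L p.2))) ∧
    (¬ GenericSubstructure.Splits (L.age M) →
      (∀ᶠ χ : M → Bool in residual (M → Bool),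
        GenericSubstructure.IsGlobal (GenericSubstructure.ofChar L χ)) ∧
      (∀ᶠ p : (M → Bool) × (M → Bool) in residual ((M → Bool) × (M → Bool)),
        GenericSubstructure.IsGlobalPair
          (GenericSubstructure.ofChar L p.1) (GenericSubstructure.ofChar L p.2))) := by
  have h₁ := GenericSubstructure.eventually_realizesTypes hM'
  have h₂ := GenericSubstructure.eventually_pair h₁
  refine ⟨fun hs => ?_, fun hns => ?_⟩
  · obtain ⟨C, hC, hdet⟩ := GenericSubstructure.exists_not_determines hM hs
    refine ⟨h₁.mono fun χ hχ => ?_, h₂.mono fun p hp => ⟨?_, ?_⟩⟩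
    · exact GenericSubstructure.isMeagre_extendable hχ hχ hC hdet
    · exact GenericSubstructure.nonempty_equiv hp.1 hp.2
    · exact GenericSubstructure.isMeagre_extendable hp.1 hp.2 hC hdet
  · have hdet := fun (C : Set M) (hC : C.Finite) =>
      GenericSubstructure.exists_determines hM hns hC
    refine ⟨h₁.mono fun χ hχ => ?_, h₂.mono fun p hp => ⟨?_, ?_⟩⟩
    · exact GenericSubstructure.extendable_eq_univ hM hχ hχ hdet
    · exact GenericSubstructure.nonempty_equiv hp.1 hp.2
    · exact GenericSubstructure.extendable_eq_univ hM hp.1 hp.2 hdet
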